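/- Let $k$ be a commutative ring and let $\mathbf{Aff}_k$ be the category of affine schemes over $k$. A morphism $f\colon Y\to X$ in $\mathbf{Aff}_k$ is a *canonical covering* if it is a covering for the canonical topology on $\mathbf{Aff}_k$, i.e. the finest Grothendieck topology for which all representable presheaves are sheaves. Write $\hat{\mathcal O}_{X,x}$ for the completion of the local ring $\mathcal O_{X,x}$ with respect to its maximal ideal. For a morphism $f\colon Y\to X$ in $\mathbf{Aff}_k$ put $$X'=\operatorname{Spec}\prod_{x\in X}\hat{\mathcal O}_{X,x},\qquad Y'=\operatorname{Spec}\prod_{x\in X}\bigl(\mathcal O(Y)\otimes_{\mathcal O(X)}\hat{\mathcal O}_{X,x}\bigr),$$ and let $e\colon X'\to X$, $Y'\to Y$ and $f'\colon Y'\to X'$ be the morphisms given by the natural ring maps $\mathcal O(X)\to\prod_x\hat{\mathcal O}_{X,x}$, $\mathcal O(Y)\to\prod_x(\mathcal O(Y)\otimes\hat{\mathcal O}_{X,x})$, $s\mapsto(s\otimes1)_x$, and $\prod_x\hat{\mathcal O}_{X,x}\to\prod_x(\mathcal O(Y)\otimes\hat{\mathcal O}_{X,x})$, $(a_x)_x\mapsto(1\otimes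 a_x)_x$. These form a commutative square in $\mathbf{Aff}_k$ $$\begin{array}{ccc}Y'&\xrightarrow{f'}&X'\\ \downarrow&&\downarrow{\scriptstyle e}\\ Y&\xrightarrow{f}&X.\end{array}$$ (1) If $X$ is Noetherian and $f$ is a canonical covering, then $e$ is faithfully flat, and $f'^{*}\colon\mathcal O(X')\to\mathcal O(Y')$ splits as a map of $\mathcal O(X')$-modules, i.e. has an $\mathcal O(X')$-linear retraction. (2) The construction is functorial in $f$: to a commutative square from $f_1\colon Y_1\to X_1$ to $f_2\colon Y_2\to X_2$ in $\mathbf{Aff}_k$, with right-hand side $h\colon X_1\to X_2$, attach the morphisms $X_1'\to X_2'$ and $Y_1'\to Y_2'$ given by the ring maps whose component at $x\in X_1$ is the component at $h(x)\in X_2$ followed by the map $\hat{\mathcal O}_{X_2,h(x)}\to\hat{\mathcal O}_{X_1,x}$ induced by $h$, respectively by $\mathcal O(Y_2)\otimes_{\mathcal O(X_2)}\hat{\mathcal O}_{X_2,h(x)}\to\mathcal O(Y_1)\otimes_{\mathcal O(X_1)}\hat{\mathcal O}_{X_1,x}$. Then $f\mapsto f'$ is a functor from the category of morphisms of $\mathbf{Aff}_k$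 to itself, and the commutative squares from $f'$ to $f$ above are natural in $f$. -/

import Mathlib

open CategoryTheory AlgebraicGeometry
open scoped TensorProduct

universe u

noncomputable section

/-! ### Ring-theoretic preliminaries -/

/-- A ring map `φ : R → S` splits as `R`-modules: there is an `R`-linear retraction of `φ`. -/
def SplitsAsModules {R S : Type u} [CommRing R] [CommRing S] (φ : R →+* S) : Prop :=
  letI := φ.toAlgebra
  ∃ r : S →ₗ[R] R, ∀ a : R, r (φ a) = a

/-- The tensor product `S ⊗_R A` of two `R`-algebras given by ring maps `R → S`, `R → A`. -/
def TensorOf {R S A : Type u} [CommRing R] [CommRing S] [CommRing A]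
    (φ : R →+* S) (γ : R →+* A) : Type u :=
  letI := φ.toAlgebra
  letI := γ.toAlgebra
  S ⊗[R] A

namespace TensorOf

section

variable {R S A : Type u} [CommRing R] [CommRing S] [CommRing A] (φ : R →+* S) (γ : R →+* A)

instance : CommRing (TensorOf φ γ) :=
  @Algebra.TensorProduct.instCommRing R S A _ _ φ.toAlgebra _ γ.toAlgebra

/-- `s ↦ s ⊗ 1`. -/
def inl : S →+* TensorOf φ γ :=
  letI := φ.toAlgebra
  letI := γ.toAlgebra
  (Algebra.TensorProduct.includeLeftRingHom : S →+* S ⊗[R] A)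

/-- `a ↦ 1 ⊗ a`. -/
def inr : A →+* TensorOf φ γ :=
  letI := φ.toAlgebra
  letI := γ.toAlgebra
  (Algebra.TensorProduct.includeRight : A →ₐ[R] S ⊗[R] A).toRingHom

lemma inl_comp : (inl φ γ).comp φ = (inr φ γ).comp γ := by
  let := φ.toAlgebra
  let := γ.toAlgebra
  exact Algebra.TensorProduct.includeLeftRingHom_comp_algebraMap

lemma ringHom_ext {B : Type u} [CommRing B] {f g : TensorOf φ γ →+* B}
    (hl : f.comp (inl φ γ) = g.comp (inl φ γ)) (hr : f.comp (inr φ γ) = g.comp (inr φ γ)) :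
    f = g := by
  let := φ.toAlgebra
  let := γ.toAlgebra
  exact Algebra.TensorProduct.ringHom_ext (R := R) (A := S) (B := A) hl hr

end

section

variable {R S A R' S' A' : Type u} [CommRing R] [CommRing S] [CommRing A]
  [CommRing R'] [CommRing S'] [CommRing A']
  {φ : R →+* S} {γ : R →+* A} {φ' : R' →+* S'} {γ' : R' →+* A'}

/-- The ring map `s ⊗ a ↦ fS s ⊗ fA a`, for ring maps `fS` and `fA` over `fR`. -/
def map (fR : R →+* R') (fS : S →+* S') (fA : A →+* A')
    (hS : fS.comp φ = φ'.comp fR) (hA : fA.comp γ = γ'.comp fR) :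
    TensorOf φ γ →+* TensorOf φ' γ' :=
  letI := φ.toAlgebra
  letI := γ.toAlgebra
  letI := φ'.toAlgebra
  letI := γ'.toAlgebra
  (Algebra.TensorProduct.mapRingHom fR fS fA hS hA : S ⊗[R] A →+* S' ⊗[R'] A')

variable (fR : R →+* R') (fS : S →+* S') (fA : A →+* A')
    (hS : fS.comp φ = φ'.comp fR) (hA : fA.comp γ = γ'.comp fR)

lemma map_comp_inl : (map fR fS fA hS hA).comp (inl φ γ) = (inl φ' γ').comp fS := by
  let := φ.toAlgebra
  let := γ.toAlgebra
  let := φ'.toAlgebra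
  let := γ'.toAlgebra
  exact Algebra.TensorProduct.mapRingHom_comp_includeLeftRingHom fR fS fA hS hA

lemma map_comp_inr : (map fR fS fA hS hA).comp (inr φ γ) = (inr φ' γ').comp fA := by
  let := φ.toAlgebra
  let := γ.toAlgebra
  let := φ'.toAlgebra
  let := γ'.toAlgebra
  exact Algebra.TensorProduct.mapRingHom_comp_includeRight fR fS fA hS hA

end

end TensorOf

/-! ### The completed local rings of a scheme -/

/-- The completion `Ô_{X,x}` of the local ring of `X` at `x`, for the topology given by the powers
of its maximal ideal. -/
abbrev CompletedStalk (X : Scheme.{u}) (x : X) : Type u :=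
  AdicCompletion (IsLocalRing.maximalIdeal (X.presheaf.stalk x)) (X.presheaf.stalk x)

/-- The canonical map `O(X) → O_{X,x} → Ô_{X,x}`. -/
def toCompletedStalk (X : Scheme.{u}) (x : X) : Γ(X, ⊤) →+* CompletedStalk X x :=
  (algebraMap (X.presheaf.stalk x) (CompletedStalk X x)).comp
    (X.presheaf.germ ⊤ x trivial).hom

/-- A local ring map `A → B` induces compatible maps `A / 𝔪_A ^ n → B / 𝔪_B ^ n`. -/
def localQuotientMap {A B : Type u} [CommRing A] [IsLocalRing A] [CommRing B] [IsLocalRing B]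
    (φ : A →+* B) [IsLocalHom φ] (n : ℕ) :
    A ⧸ IsLocalRing.maximalIdeal A ^ n →+* B ⧸ IsLocalRing.maximalIdeal B ^ n :=
  Ideal.quotientMap _ φ <| Ideal.map_le_iff_le_comap.mp <| by
    rw [Ideal.map_pow]
    exact Ideal.pow_right_mono (((IsLocalRing.local_hom_TFAE φ).out 0 2).mp ‹IsLocalHom φ›) n

lemma localQuotientMap_compatible {A B : Type u} [CommRing A] [IsLocalRing A] [CommRing B]
    [IsLocalRing B] (φ : A →+* B) [IsLocalHom φ] {m n : ℕ} (hle : m ≤ n) :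
    (Ideal.Quotient.factorPow (IsLocalRing.maximalIdeal B) hle).comp
      ((localQuotientMap φ n).comp
        (AdicCompletion.evalₐ (IsLocalRing.maximalIdeal A) n :
          AdicCompletion (IsLocalRing.maximalIdeal A) A →+* _)) =
      (localQuotientMap φ m).comp
        (AdicCompletion.evalₐ (IsLocalRing.maximalIdeal A) m :
          AdicCompletion (IsLocalRing.maximalIdeal A) A →+* _) := by
  refine RingHom.ext fun x ↦ ?_
  induction x using AdicCompletion.induction_on with
  | _ a =>
    have h : Ideal.Quotient.mk (IsLocalRing.maximalIdeal A ^ m) (a.val n) =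
        Ideal.Quotient.mk (IsLocalRing.maximalIdeal A ^ m) (a.val m) := by
      rw [Ideal.Quotient.mk_eq_mk_iff_sub_mem]
      simpa [SModEq.sub_mem] using (a.property hle).symm
    have h' := congrArg (localQuotientMap φ m) h
    simpa [localQuotientMap] using h'

/-- The map on completions of local rings induced by a local ring map: the limit of the maps
`A / 𝔪_A ^ n → B / 𝔪_B ^ n`. -/
def completedLocalMap {A B : Type u} [CommRing A] [IsLocalRing A] [CommRing B] [IsLocalRing B]
    (φ : A →+* B) [IsLocalHom φ] :
    AdicCompletion (IsLocalRing.maximalIdeal A) A →+*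
      AdicCompletion (IsLocalRing.maximalIdeal B) B :=
  AdicCompletion.liftRingHom _
    (fun n ↦ (localQuotientMap φ n).comp
      (AdicCompletion.evalₐ (IsLocalRing.maximalIdeal A) n : _ →+* _))
    (localQuotientMap_compatible φ)

lemma evalₐ_completedLocalMap {A B : Type u} [CommRing A] [IsLocalRing A] [CommRing B]
    [IsLocalRing B] (φ : A →+* B) [IsLocalHom φ] (n : ℕ)
    (x : AdicCompletion (IsLocalRing.maximalIdeal A) A) :
    AdicCompletion.evalₐ (IsLocalRing.maximalIdeal B) n (completedLocalMap φ x) =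
      localQuotientMap φ n (AdicCompletion.evalₐ (IsLocalRing.maximalIdeal A) n x) :=
  AdicCompletion.evalₐ_liftRingHom _ _ (localQuotientMap_compatible φ) n x

lemma completedLocalMap_algebraMap {A B : Type u} [CommRing A] [IsLocalRing A] [CommRing B]
    [IsLocalRing B] (φ : A →+* B) [IsLocalHom φ] (a : A) :
    completedLocalMap φ (algebraMap A _ a) = algebraMap B _ (φ a) := by
  refine AdicCompletion.ext_evalₐ fun n ↦ ?_
  rw [evalₐ_completedLocalMap]
  simp [localQuotientMap, AdicCompletion.algebraMap_apply]

/-- The map `Ô_{Y,f(x)} → Ô_{X,x}` induced by a morphism `f : X → Y`. -/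
def completedStalkMap {X Y : Scheme.{u}} (f : X ⟶ Y) (x : X) :
    CompletedStalk Y (f x) →+* CompletedStalk X x :=
  completedLocalMap (f.stalkMap x).hom

lemma completedStalkMap_comp_toCompletedStalk {X Y : Scheme.{u}} (f : X ⟶ Y) (x : X) :
    (completedStalkMap f x).comp (toCompletedStalk Y (f x)) =
      (toCompletedStalk X x).comp f.appTop.hom := by
  refine RingHom.ext fun a ↦ ?_
  simp only [completedStalkMap, toCompletedStalk, RingHom.comp_apply,
    completedLocalMap_algebraMap]
  refine congrArg _ ?_
  exact Scheme.Hom.germ_stalkMap_apply f ⊤ x trivial a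

/-! ### Affine schemes over a ring, and canonical coverings -/

/-- The category of affine schemes over a commutative ring `k`. -/
abbrev Aff (k : Type u) [CommRing k] : Type (u + 1) :=
  ObjectProperty.FullSubcategory
    fun X : Over (Spec (CommRingCat.of k)) ↦ IsAffine X.left

namespace Aff

variable {k : Type u} [CommRing k]

/-- The underlying scheme of an affine `k`-scheme. -/
abbrev scheme (X : Aff k) : Scheme.{u} := X.obj.left

instance (X : Aff k) : IsAffine X.scheme := X.property

/-- The underlying morphism of schemes of a morphism of affine `k`-schemes. -/
abbrev toScheme {X Y : Aff k} (f : X ⟶ Y) : X.scheme ⟶ Y.scheme := f.hom.left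

/-- The ring map `O(Y) → O(X)` induced by `f : X → Y`. -/
abbrev comorphism {X Y : Aff k} (f : X ⟶ Y) : Γ(Y.scheme, ⊤) →+* Γ(X.scheme, ⊤) :=
  (toScheme f).appTop.hom

/-- `f : Y → X` is a canonical covering: the sieve that it generates is a covering sieve for the
canonical topology of the category of affine `k`-schemes, i.e. for the finest Grothendieck topology
for which all representable presheaves are sheaves. -/
def IsCanonicalCovering {X Y : Aff k} (f : Y ⟶ X) : Prop :=
  Sieve.generate (Presieve.singleton f) ∈ Sheaf.canonicalTopology (Aff k) X

/-- A morphism is faithfully flat if it is flat and surjective. -/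
def IsFaithfullyFlat {X Y : Aff k} (f : Y ⟶ X) : Prop :=
  Flat (toScheme f) ∧ Surjective (toScheme f)

/-- The morphism `Spec A → X` given by a ring map `O(X) → A`, for `X` affine. -/
def specTo (X : Aff k) {A : Type u} [CommRing A] (φ : Γ(X.scheme, ⊤) →+* A) :
    Spec (CommRingCat.of A) ⟶ X.scheme :=
  Spec.map (CommRingCat.ofHom φ) ≫ X.scheme.isoSpec.inv

/-- `Spec A` as an affine `k`-scheme, for a ring map `O(X) → A` with `X` an affine `k`-scheme. -/
def specOver (X : Aff k) {A : Type u} [CommRing A] (φ : Γ(X.scheme, ⊤) →+* A) : Aff k where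
  obj := Over.mk (specTo X φ ≫ X.obj.hom)
  property := inferInstanceAs (IsAffine (Spec (CommRingCat.of A)))

/-- The structural morphism `Spec A → X`. -/
def specOverTo (X : Aff k) {A : Type u} [CommRing A] (φ : Γ(X.scheme, ⊤) →+* A) :
    specOver X φ ⟶ X :=
  ObjectProperty.homMk (Over.homMk (specTo X φ) rfl)

lemma specMap_comp_specTo {X Y : Aff k} (h : X ⟶ Y) {A B : Type u} [CommRing A] [CommRing B]
    (φ : Γ(X.scheme, ⊤) →+* A) (ψ : Γ(Y.scheme, ⊤) →+* B) (α : B →+* A)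
    (w : α.comp ψ = φ.comp (comorphism h)) :
    Spec.map (CommRingCat.ofHom α) ≫ specTo Y ψ = specTo X φ ≫ toScheme h := by
  simp only [specTo, Category.assoc]
  rw [← Scheme.isoSpec_inv_naturality, ← Spec.map_comp_assoc, ← Spec.map_comp_assoc]
  congr 2
  ext b
  exact congr($w b)

/-- The morphism `Spec A → Spec B` over `h : X → Y` given by a ring map `B → A` compatible with
`O(Y) → O(X)`. -/
def specOverMap {X Y : Aff k} (h : X ⟶ Y) {A B : Type u} [CommRing A] [CommRing B]
    (φ : Γ(X.scheme, ⊤) →+* A) (ψ : Γ(Y.scheme, ⊤) →+* B) (α : B →+* A)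
    (w : α.comp ψ = φ.comp (comorphism h)) : specOver X φ ⟶ specOver Y ψ :=
  ObjectProperty.homMk <| Over.homMk (Spec.map (CommRingCat.ofHom α)) <| by
    have := Over.w h.hom
    simp only [specOver, Over.mk_left, Over.mk_hom]
    rw [← Category.assoc, specMap_comp_specTo h φ ψ α w, Category.assoc]
    exact congrArg (specTo X φ ≫ ·) this

lemma specOverMap_comp_specOverTo {X Y : Aff k} (h : X ⟶ Y) {A B : Type u} [CommRing A]
    [CommRing B] (φ : Γ(X.scheme, ⊤) →+* A) (ψ : Γ(Y.scheme, ⊤) →+* B) (α : B →+* A)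
    (w : α.comp ψ = φ.comp (comorphism h)) :
    specOverMap h φ ψ α w ≫ specOverTo Y ψ = specOverTo X φ ≫ h := by
  ext : 2
  exact specMap_comp_specTo h φ ψ α w

lemma specOverMap_comp_specOverMap {X Y Z : Aff k} (h : X ⟶ Y) (h' : Y ⟶ Z) (h'' : X ⟶ Z)
    {A B C : Type u} [CommRing A] [CommRing B] [CommRing C]
    (φ : Γ(X.scheme, ⊤) →+* A) (ψ : Γ(Y.scheme, ⊤) →+* B) (χ : Γ(Z.scheme, ⊤) →+* C)
    (α : B →+* A) (β : C →+* B) (δ : C →+* A)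
    (w : α.comp ψ = φ.comp (comorphism h)) (w' : β.comp χ = ψ.comp (comorphism h'))
    (w'' : δ.comp χ = φ.comp (comorphism h'')) (e : δ = α.comp β) :
    specOverMap h φ ψ α w ≫ specOverMap h' ψ χ β w' = specOverMap h'' φ χ δ w'' := by
  subst e
  ext : 2
  exact (Spec.map_comp _ _).symm

/-! ### The construction -/

/-- The ring `∏_{x ∈ X} Ô_{X,x}`. -/
abbrev ProdCompletion (X : Aff k) : Type u :=
  ∀ x : X.scheme, CompletedStalk X.scheme x

/-- The diagonal map `O(X) → ∏_{x ∈ X} Ô_{X,x}`. -/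
def toProdCompletion (X : Aff k) : Γ(X.scheme, ⊤) →+* ProdCompletion X :=
  RingHom.pi fun x ↦ toCompletedStalk X.scheme x

/-- The map `∏_{y ∈ Y} Ô_{Y,y} → ∏_{x ∈ X} Ô_{X,x}` induced by `h : X → Y`: the component at `x` of
the image of `a` is the image of the component of `a` at `h(x)` under `Ô_{Y,h(x)} → Ô_{X,x}`. -/
def prodCompletionMap {X Y : Aff k} (h : X ⟶ Y) : ProdCompletion Y →+* ProdCompletion X :=
  RingHom.pi fun x ↦ (completedStalkMap (toScheme h) x).comp (Pi.evalRingHom _ (toScheme h x))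

lemma prodCompletionMap_comp {X Y : Aff k} (h : X ⟶ Y) :
    (prodCompletionMap h).comp (toProdCompletion Y) =
      (toProdCompletion X).comp (comorphism h) := by
  refine RingHom.ext fun a ↦ funext fun x ↦ ?_
  exact congr($(completedStalkMap_comp_toCompletedStalk (toScheme h) x) a)

/-- The ring `O(Y) ⊗_{O(X)} Ô_{X,x}`, for `f : Y → X` and `x ∈ X`. -/
abbrev CompletedFibre {X Y : Aff k} (f : Y ⟶ X) (x : X.scheme) : Type u :=
  TensorOf (comorphism f) (toCompletedStalk X.scheme x)

/-- The ring `∏_{x ∈ X} (O(Y) ⊗_{O(X)} Ô_{X,x})`. -/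
abbrev ProdCompletedFibre {X Y : Aff k} (f : Y ⟶ X) : Type u :=
  ∀ x : X.scheme, CompletedFibre f x

/-- The diagonal map `O(Y) → ∏_{x ∈ X} (O(Y) ⊗_{O(X)} Ô_{X,x})`. -/
def toProdCompletedFibre {X Y : Aff k} (f : Y ⟶ X) :
    Γ(Y.scheme, ⊤) →+* ProdCompletedFibre f :=
  RingHom.pi fun x ↦ TensorOf.inl (comorphism f) (toCompletedStalk X.scheme x)

/-- The map `∏_{x ∈ X} Ô_{X,x} → ∏_{x ∈ X} (O(Y) ⊗_{O(X)} Ô_{X,x})`, the product over `x ∈ X` of the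
maps `a ↦ 1 ⊗ a`. -/
def prodToProdFibre {X Y : Aff k} (f : Y ⟶ X) : ProdCompletion X →+* ProdCompletedFibre f :=
  RingHom.pi fun x ↦ (TensorOf.inr (comorphism f) (toCompletedStalk X.scheme x)).comp
    (Pi.evalRingHom _ x)

lemma prodToProdFibre_comp {X Y : Aff k} (f : Y ⟶ X) :
    (prodToProdFibre f).comp (toProdCompletion X) =
      (toProdCompletedFibre f).comp (comorphism f) := by
  refine RingHom.ext fun a ↦ funext fun x ↦ ?_
  exact congr($((TensorOf.inl_comp (comorphism f) (toCompletedStalk X.scheme x)).symm) a)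

lemma comorphism_comp_of_square {f₁ f₂ : Arrow (Aff k)} (φ : f₁ ⟶ f₂) :
    (comorphism φ.left).comp (comorphism f₂.hom) =
      (comorphism f₁.hom).comp (comorphism φ.right) := by
  have h : toScheme φ.left ≫ toScheme f₂.hom = toScheme f₁.hom ≫ toScheme φ.right :=
    congrArg toScheme (Arrow.w φ)
  have h' := congr(($h).appTop.hom)
  simpa only [Scheme.Hom.comp_appTop, CommRingCat.hom_comp] using h'

/-- The map `∏_{x ∈ X₂} (O(Y₂) ⊗ Ô_{X₂,x}) → ∏_{x ∈ X₁} (O(Y₁) ⊗ Ô_{X₁,x})` induced by a commutative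
square from `f₁ : Y₁ → X₁` to `f₂ : Y₂ → X₂` with right-hand side `h : X₁ → X₂`: the component at
`x ∈ X₁` of the image of `b` is the image of the component of `b` at `h(x)`. -/
def prodFibreMap {f₁ f₂ : Arrow (Aff k)} (φ : f₁ ⟶ f₂) :
    ProdCompletedFibre f₂.hom →+* ProdCompletedFibre f₁.hom :=
  RingHom.pi fun x ↦
    (TensorOf.map (comorphism φ.right) (comorphism φ.left)
      (completedStalkMap (toScheme φ.right) x)
      (comorphism_comp_of_square φ)
      (completedStalkMap_comp_toCompletedStalk (toScheme φ.right) x)).comp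
    (Pi.evalRingHom _ (toScheme φ.right x))

lemma prodFibreMap_comp {f₁ f₂ : Arrow (Aff k)} (φ : f₁ ⟶ f₂) :
    (prodFibreMap φ).comp (toProdCompletedFibre f₂.hom) =
      (toProdCompletedFibre f₁.hom).comp (comorphism φ.left) := by
  refine RingHom.ext fun a ↦ funext fun x ↦ ?_
  exact congr($(TensorOf.map_comp_inl (comorphism φ.right) (comorphism φ.left)
      (completedStalkMap (toScheme φ.right) x)
      (comorphism_comp_of_square φ)
      (completedStalkMap_comp_toCompletedStalk (toScheme φ.right) x)) a)

lemma prodFibreMap_comp_prodToProdFibre {f₁ f₂ : Arrow (Aff k)} (φ : f₁ ⟶ f₂) :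
    (prodFibreMap φ).comp (prodToProdFibre f₂.hom) =
      (prodToProdFibre f₁.hom).comp (prodCompletionMap φ.right) := by
  refine RingHom.ext fun a ↦ funext fun x ↦ ?_
  exact congr($(TensorOf.map_comp_inr (comorphism φ.right) (comorphism φ.left)
      (completedStalkMap (toScheme φ.right) x)
      (comorphism_comp_of_square φ)
      (completedStalkMap_comp_toCompletedStalk (toScheme φ.right) x)) (a _))

/-- `X' = Spec ∏_{x ∈ X} Ô_{X,x}`. -/
def baseObj (X : Aff k) : Aff k := specOver X (toProdCompletion X)

/-- The morphism `e : X' → X`. -/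
def baseTo (X : Aff k) : baseObj X ⟶ X := specOverTo X (toProdCompletion X)

/-- The morphism `X₁' → X₂'` induced by `X₁ → X₂`. -/
def baseMap {X₁ X₂ : Aff k} (h : X₁ ⟶ X₂) : baseObj X₁ ⟶ baseObj X₂ :=
  specOverMap h _ _ (prodCompletionMap h) (prodCompletionMap_comp h)

/-- `Y' = Spec ∏_{x ∈ X} (O(Y) ⊗_{O(X)} Ô_{X,x})`. -/
def totalObj (f : Arrow (Aff k)) : Aff k := specOver f.left (toProdCompletedFibre f.hom)

/-- The morphism `Y' → Y`. -/
def totalTo (f : Arrow (Aff k)) : totalObj f ⟶ f.left :=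
  specOverTo f.left (toProdCompletedFibre f.hom)

/-- The morphism `Y₁' → Y₂'` induced by a commutative square. -/
def totalMap {f₁ f₂ : Arrow (Aff k)} (φ : f₁ ⟶ f₂) : totalObj f₁ ⟶ totalObj f₂ :=
  specOverMap φ.left _ _ (prodFibreMap φ) (prodFibreMap_comp φ)

/-- The morphism `f' : Y' → X'`. -/
def totalToBase (f : Arrow (Aff k)) : totalObj f ⟶ baseObj f.right :=
  specOverMap f.hom _ _ (prodToProdFibre f.hom) (prodToProdFibre_comp f.hom)

lemma totalMap_comp {f₁ f₂ : Arrow (Aff k)} (φ : f₁ ⟶ f₂) :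
    totalMap φ ≫ totalToBase f₂ = totalToBase f₁ ≫ baseMap φ.right := by
  have w : ((prodFibreMap φ).comp (prodToProdFibre f₂.hom)).comp (toProdCompletion f₂.right) =
      (toProdCompletedFibre f₁.hom).comp (comorphism (φ.left ≫ f₂.hom)) := by
    rw [RingHom.comp_assoc, prodToProdFibre_comp, ← RingHom.comp_assoc, prodFibreMap_comp,
      RingHom.comp_assoc]
    congr 1
  refine (specOverMap_comp_specOverMap φ.left f₂.hom (φ.left ≫ f₂.hom) _ _ _ _ _ _ _ _ w rfl).trans
    ?_
  have w' := w
  rw [Arrow.w φ] at w'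
  refine Eq.trans ?_ (specOverMap_comp_specOverMap f₁.hom φ.right (f₁.hom ≫ φ.right) _ _ _ _ _ _ _ _
    w' (prodFibreMap_comp_prodToProdFibre φ)).symm
  ext : 2
  rfl

/-- The construction `(f : Y → X) ↦ (f' : Y' → X')`, on morphisms of affine `k`-schemes and on
commutative squares between them. -/
def completion (k : Type u) [CommRing k] : Arrow (Aff k) ⥤q Arrow (Aff k) where
  obj f := Arrow.mk (totalToBase f)
  map φ := Arrow.homMk (totalMap φ) (baseMap φ.right) (totalMap_comp φ)

/-- The commutative square from `f' : Y' → X'` to `f : Y → X`, with vertical maps `Y' → Y` and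
`e : X' → X`. -/
def completionSquare (f : Arrow (Aff k)) : (completion k).obj f ⟶ f :=
  Arrow.homMk (totalTo f) (baseTo f.right)
    (specOverMap_comp_specOverTo f.hom _ _ (prodToProdFibre f.hom) (prodToProdFibre_comp f.hom)).symm

end Aff

end

/-! The splitting is a compactness phenomenon. A canonical covering is universally injective on
functions: an element of an `O(X)`-algebra `A` is an `X`-morphism from `Spec A` to the affine line
over `X`, and the presheaf represented by that line is separated for the canonical topology
(`Aff.IsCanonicalCovering.inr_injective`). So each `Ô_{X,x} → O(Y) ⊗ Ô_{X,x}` is pure, and testing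
purity on a square-zero extension shows that finite linear systems solvable upstairs are solvable in
`Ô_{X,x}` (`IsPureRingHom.exists_solution`). A retraction is a solution of an infinite system, with
one unknown for each element upstairs. Since `X` is Noetherian, `Ô_{X,x}` is a limit of Artinian
quotients, and over Artinian modules finite solvability implies solvability
(`IsArtinian.exists_forall_eq_of_finset`, used through `exists_linearForm_eq_one`). The retractions
at the points `x` are then multiplied together.

For `e`, products of flat modules over a Noetherian ring are flat
(`Module.Flat.pi_of_isNoetherianRing`), and each point `x` is hit through the residue field of the
factor at `x`. Functoriality is checked on ring maps, modulo powers of the maximal ideals and on the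
two tensor factors. -/

/-! ### Linear systems over Artinian modules -/

/-- A system of linear equations, each in finitely many of the unknowns `x i ∈ M i`, where all
`M i` are Artinian, has a solution if all its finite subsystems have one. -/
theorem IsArtinian.exists_forall_eq_of_finset {R ι κ : Type*} [Ring R] {M : ι → Type*}
    [∀ i, AddCommGroup (M i)] [∀ i, Module R (M i)] [∀ i, IsArtinian R (M i)]
    {P : κ → Type*} [∀ k, AddCommGroup (P k)] [∀ k, Module R (P k)]
    (T : ∀ k, (∀ i, M i) →ₗ[R] P k) (t : ∀ k, P k)
    (hT : ∀ k, ∃ s : Finset ι, ∀ x y : ∀ i, M i, (∀ i ∈ s, x i = y i) → T k x = T k y)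
    (ht : ∀ K : Finset κ, ∃ x, ∀ k ∈ K, T k x = t k) :
    ∃ x, ∀ k, T k x = t k := by
  classical
  -- Families of prescribed values `x i = m`, every finite part of which is compatible with every
  -- finite subsystem. This condition has finite character, so a maximal family exists.
  let 𝒢 : Set (Set (Σ i, M i)) := {G | ∀ (K : Finset κ) (F : Finset (Σ i, M i)), ↑F ⊆ G →
    ∃ x : ∀ i, M i, (∀ k ∈ K, T k x = t k) ∧ ∀ p ∈ F, x p.1 = p.2}
  have hfin : Order.IsOfFiniteCharacter 𝒢 := fun G ↦
    ⟨fun hG H hH _ K F hF ↦ hG K F (hF.trans hH),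
      fun hG K F hF ↦ hG F hF F.finite_toSet K F subset_rfl⟩
  have hempty : ∅ ∈ 𝒢 := fun K F hF ↦ by
    obtain ⟨x, hx⟩ := ht K
    exact ⟨x, hx, fun p hp ↦ (hF hp).elim⟩
  obtain ⟨G, -, hG⟩ := hfin.exists_maximal hempty
  have key (i : ι) : ∃ m, (⟨i, m⟩ : Σ i, M i) ∈ G := by
    -- `H q` is the solution space of the homogeneous system attached to `q`, and `D q` the set of
    -- its `i`-th coordinates, along which the value at `i` can still vary. The Artinian condition
    -- yields a `q₀` for which this freedom is least.
    let H (q : Finset κ × Finset (Σ i, M i)) : Submodule R (∀ i, M i) :=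
      { carrier := {y | (∀ k ∈ q.1, T k y = 0) ∧ ∀ p ∈ q.2, y p.1 = 0}
        add_mem' := fun {a b} ha hb ↦ ⟨fun k hk ↦ by simp [ha.1 k hk, hb.1 k hk],
          fun p hp ↦ by simp [ha.2 p hp, hb.2 p hp]⟩
        zero_mem' := by simp
        smul_mem' := fun c a ha ↦ ⟨fun k hk ↦ by simp [ha.1 k hk],
          fun p hp ↦ by simp [ha.2 p hp]⟩ }
    let D (q : Finset κ × Finset (Σ i, M i)) : Submodule R (M i) :=
      (H q).map (LinearMap.proj i)
    obtain ⟨_, ⟨q₀, hq₀, rfl⟩, hmin⟩ := IsArtinian.set_has_minimal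
      (D '' {q | (q.2 : Set (Σ i, M i)) ⊆ G}) ⟨_, (∅, ∅), by simp, rfl⟩
    obtain ⟨x₀, hx₀, hx₀'⟩ := hG.prop q₀.1 q₀.2 hq₀
    refine ⟨x₀ i, ?_⟩
    suffices h : insert ⟨i, x₀ i⟩ G ∈ 𝒢 from
      hG.le_of_ge h (Set.subset_insert _ _) (Set.mem_insert _ _)
    intro K F hF
    let q₁ : Finset κ × Finset (Σ i, M i) := (K ∪ q₀.1, F.erase ⟨i, x₀ i⟩ ∪ q₀.2)
    have hq₁ : (q₁.2 : Set (Σ i, M i)) ⊆ G := by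
      simp only [q₁, Finset.coe_union, Set.union_subset_iff, Finset.coe_erase]
      exact ⟨by simpa using hF, hq₀⟩
    have hle : D q₁ ≤ D q₀ := Submodule.map_mono fun y hy ↦
      ⟨fun k hk ↦ hy.1 k (Finset.mem_union_right _ hk),
        fun p hp ↦ hy.2 p (Finset.mem_union_right _ hp)⟩
    -- Further constraints cannot shrink `D q₀`. So a solution for `q₁` can be corrected by a
    -- homogeneous one to take the value `x₀ i` at `i`.
    have heq : D q₁ = D q₀ := hle.eq_of_not_lt (hmin _ ⟨q₁, hq₁, rfl⟩)
    obtain ⟨x₁, hx₁, hx₁'⟩ := hG.prop q₁.1 q₁.2 hq₁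
    have hmem : x₁ i - x₀ i ∈ D q₁ := by
      rw [heq]
      refine ⟨x₁ - x₀, ⟨fun k hk ↦ ?_, fun p hp ↦ ?_⟩, rfl⟩
      · rw [map_sub, hx₀ k hk, hx₁ k (Finset.mem_union_right _ hk), sub_self]
      · rw [Pi.sub_apply, hx₀' p hp, hx₁' p (Finset.mem_union_right _ hp), sub_self]
    obtain ⟨y, ⟨hy, hy'⟩, hyi⟩ := hmem
    replace hyi : y i = x₁ i - x₀ i := hyi
    refine ⟨x₁ - y, fun k hk ↦ ?_, fun p hp ↦ ?_⟩
    · have hk' := Finset.mem_union_left q₀.1 hk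
      rw [map_sub, hx₁ k hk', hy k hk', sub_zero]
    · by_cases hpi : p = ⟨i, x₀ i⟩
      · subst hpi
        simp [hyi]
      · have hp' : p ∈ q₁.2 := Finset.mem_union_left _ (Finset.mem_erase.mpr ⟨hpi, hp⟩)
        rw [Pi.sub_apply, hx₁' p hp', hy' p hp', sub_zero]
  choose x hx using key
  refine ⟨x, fun k ↦ ?_⟩
  obtain ⟨s, hs⟩ := hT k
  -- Equation `k` sees only the coordinates in `s`, and `G` provides a solution of it with the
  -- chosen values there.
  obtain ⟨y, hy, hy'⟩ := hG.prop {k} (s.image fun i ↦ ⟨i, x i⟩) <| by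
    simp only [Finset.coe_image, Set.image_subset_iff]
    exact fun i _ ↦ hx i
  rw [hs x y fun i hi ↦ (hy' _ (Finset.mem_image_of_mem _ hi)).symm]
  exact hy k (by simp)

/-- Let `A` be complete and separated for the ideals `J n`, with all `A ⧸ J n` Artinian. An element
`b₀` of an `A`-module `B` is sent to `1` by a linear form, if all finite systems of linear
equations that hold in `B`, with right-hand sides multiples of `b₀`, can be solved in `A`. -/
theorem exists_linearForm_eq_one {A B : Type*} [CommRing A] [AddCommGroup B] [Module A B]
    (J : ℕ → Ideal A) (hJ : Antitone J) [∀ n, IsArtinian A (A ⧸ J n)]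
    (hsep : ∀ a, (∀ n, a ∈ J n) → a = 0)
    (hcomplete : ∀ x : ℕ → A, (∀ n, x (n + 1) - x n ∈ J n) → ∃ a, ∀ n, a - x n ∈ J n)
    (b₀ : B)
    (hpure : ∀ s : Finset ((B →₀ A) × A),
      (∀ p ∈ s, Finsupp.linearCombination A id p.1 = p.2 • b₀) →
      ∃ x : B → A, ∀ p ∈ s, Finsupp.linearCombination A x p.1 = p.2) :
    ∃ r : B →ₗ[A] A, r b₀ = 1 := by
  classical
  -- The unknown at `(b, n)` is the value of the form at `b` modulo `J n`. `T₁` imposes the linear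
  -- relations modulo each `J n`, and `T₂` the compatibility of levels `n + 1` and `n`.
  let Rel := {p : (B →₀ A) × A // Finsupp.linearCombination A id p.1 = p.2 • b₀}
  let M (i : B × ℕ) := A ⧸ J i.2
  let P (k : Rel × ℕ ⊕ B × ℕ) := A ⧸ J (k.elim Prod.snd Prod.snd)
  let π (b : B) (n : ℕ) : (∀ i, M i) →ₗ[A] A ⧸ J n :=
    (LinearMap.proj (b, n) : (∀ i, M i) →ₗ[A] M (b, n))
  let T₁ (q : Rel × ℕ) : (∀ i, M i) →ₗ[A] A ⧸ J q.2 :=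
    ∑ b ∈ q.1.1.1.support, q.1.1.1 b • π b q.2
  let T₂ (q : B × ℕ) : (∀ i, M i) →ₗ[A] A ⧸ J q.2 :=
    (Submodule.factor (hJ q.2.le_succ)).comp (π q.1 (q.2 + 1)) - π q.1 q.2
  have hT₁ (q : Rel × ℕ) (x : ∀ i, M i) :
      T₁ q x = ∑ b ∈ q.1.1.1.support, q.1.1.1 b • (x (b, q.2) : A ⧸ J q.2) := by
    simp only [T₁, LinearMap.sum_apply]
    rfl
  have hT₂ (q : B × ℕ) (x : ∀ i, M i) :
      T₂ q x = Submodule.factor (hJ q.2.le_succ) (x (q.1, q.2 + 1)) - x (q.1, q.2) := rfl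
  let T : ∀ k, (∀ i, M i) →ₗ[A] P k
    | .inl q => T₁ q
    | .inr q => T₂ q
  let t : ∀ k, P k
    | .inl q => (Submodule.Quotient.mk q.1.1.2 : A ⧸ J q.2)
    | .inr q => (0 : A ⧸ J q.2)
  obtain ⟨x, hx⟩ := IsArtinian.exists_forall_eq_of_finset (R := A) T t
    (by
      rintro (q | q)
      · refine ⟨q.1.1.1.support.image fun b ↦ (b, q.2), fun x y h ↦ ?_⟩
        change T₁ q x = T₁ q y
        rw [hT₁, hT₁]
        refine Finset.sum_congr rfl fun b hb ↦ ?_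
        rw [h _ (Finset.mem_image_of_mem _ hb)]
      · refine ⟨{(q.1, q.2 + 1), (q.1, q.2)}, fun x y h ↦ ?_⟩
        change T₂ q x = T₂ q y
        rw [hT₂, hT₂, h (q.1, q.2 + 1) (by simp), h (q.1, q.2) (by simp)])
    (by
      intro K
      let s : Finset ((B →₀ A) × A) := K.biUnion fun k ↦ k.elim (fun q ↦ {q.1.1}) fun _ ↦ ∅
      obtain ⟨x, hx⟩ := hpure s <| by
        intro p hp
        simp only [s, Finset.mem_biUnion] at hp
        obtain ⟨k | k, -, hk⟩ := hp
        · simp only [Sum.elim_inl, Finset.mem_singleton] at hk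
          exact hk ▸ k.1.2
        · simp at hk
      -- Reducing one solution in `A` modulo every `J n` gives compatibility for free.
      refine ⟨fun i ↦ (Submodule.Quotient.mk (x i.1) : A ⧸ J i.2), ?_⟩
      rintro (q | q) hq
      · have := hx q.1.1 (Finset.mem_biUnion.mpr ⟨_, hq, by simp⟩)
        change T₁ q _ = (Submodule.Quotient.mk q.1.1.2 : A ⧸ J q.2)
        rw [hT₁, ← this, Finsupp.linearCombination_apply, Finsupp.sum, ← Submodule.mkQ_apply,
          map_sum]
        rfl
      · change T₂ q _ = (0 : A ⧸ J q.2)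
        rw [hT₂]
        exact sub_self _)
  have hrel (l : B →₀ A) (c : A) (h : Finsupp.linearCombination A id l = c • b₀) (n : ℕ) :
      l.sum (fun b a ↦ a • (x (b, n) : A ⧸ J n)) = (Submodule.Quotient.mk c : A ⧸ J n) :=
    (hT₁ (⟨(l, c), h⟩, n) x).symm.trans (hx (.inl (⟨(l, c), h⟩, n)))
  have hcompat (b : B) (n : ℕ) : Submodule.factor (hJ n.le_succ) (x (b, n + 1)) = x (b, n) :=
    sub_eq_zero.mp (hx (.inr (b, n)))
  have hlift (b : B) : ∃ a : A, ∀ n, (Submodule.Quotient.mk a : A ⧸ J n) = x (b, n) := by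
    choose y hy using fun n ↦ Submodule.Quotient.mk_surjective _ (x (b, n))
    obtain ⟨a, ha⟩ := hcomplete y fun n ↦ by
      rw [← Submodule.Quotient.eq, hy n, ← hcompat, ← hy (n + 1)]
      rfl
    exact ⟨a, fun n ↦ by rw [← hy n]; exact (Submodule.Quotient.eq _).mpr (ha n)⟩
  choose r hr using hlift
  have hext {a a' : A} (h : ∀ n, (Submodule.Quotient.mk a : A ⧸ J n) = Submodule.Quotient.mk a') :
      a = a' := sub_eq_zero.mp <| hsep _ fun n ↦ (Submodule.Quotient.eq _).mp (h n)
  refine ⟨{ toFun := r, map_add' := fun b b' ↦ hext fun n ↦ ?_,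
            map_smul' := fun a b ↦ hext fun n ↦ ?_ }, hext fun n ↦ ?_⟩
  -- Additivity, homogeneity and the value at `b₀` are themselves among the imposed relations, with
  -- right-hand sides `0`, `0` and `1`.
  · have := hrel (Finsupp.single (b + b') 1 - (Finsupp.single b 1 + Finsupp.single b' 1)) 0
      (by simp) n
    rw [Finsupp.sum_sub_index (by simp [sub_smul]), Finsupp.sum_add_index' (by simp)
      (by simp [add_smul])] at this
    simp only [Finsupp.sum_single_index, zero_smul, one_smul, Submodule.Quotient.mk_zero,
      sub_eq_zero] at this
    rw [Submodule.Quotient.mk_add, hr, hr, hr, this]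
  · have := hrel (Finsupp.single (a • b) 1 - Finsupp.single b a) 0 (by simp) n
    rw [Finsupp.sum_sub_index (by simp [sub_smul])] at this
    simp only [Finsupp.sum_single_index, zero_smul, one_smul, Submodule.Quotient.mk_zero,
      sub_eq_zero] at this
    rw [RingHom.id_apply, Submodule.Quotient.mk_smul, hr, hr, this]
  · have := hrel (Finsupp.single b₀ 1) 1 (by simp) n
    simpa [← hr] using this

/-! ### Splitting over completions of Noetherian local rings -/

/-- A prime containing a power of the maximal ideal contains that ideal, so this Noetherian quotient
has Krull dimension at most zero. -/
lemma isArtinianRing_quotient_maximalIdeal_pow (O : Type*) [CommRing O] [IsLocalRing O]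
    [IsNoetherianRing O] (n : ℕ) : IsArtinianRing (O ⧸ IsLocalRing.maximalIdeal O ^ n) := by
  rw [isArtinianRing_iff_krullDimLE_zero, Ring.krullDimLE_zero_iff]
  intro P hP
  have hle : IsLocalRing.maximalIdeal O ≤ P.comap (Ideal.Quotient.mk _) := by
    refine Ideal.IsPrime.le_of_pow_le (n := n) fun a ha ↦ ?_
    rw [Ideal.mem_comap, Ideal.Quotient.eq_zero_iff_mem.mpr ha]
    exact P.zero_mem
  have hmax : (P.comap (Ideal.Quotient.mk (IsLocalRing.maximalIdeal O ^ n))).IsMaximal := by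
    rw [← (IsLocalRing.maximalIdeal.isMaximal O).eq_of_le Ideal.IsPrime.ne_top' hle]
    infer_instance
  rw [← Ideal.map_comap_of_surjective _ Ideal.Quotient.mk_surjective P]
  refine (Ideal.map_eq_top_or_isMaximal_of_surjective _ Ideal.Quotient.mk_surjective hmax
    ).resolve_left ?_
  rw [Ideal.map_comap_of_surjective _ Ideal.Quotient.mk_surjective]
  exact hP.ne_top

/-- A linear form as in `exists_linearForm_eq_one`, for the completion of a ring `O` along an ideal
`I` with all `O ⧸ I ^ n` Artinian. -/
theorem AdicCompletion.exists_linearForm_eq_one {O B : Type*} [CommRing O] (I : Ideal O)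
    [∀ n, IsArtinianRing (O ⧸ I ^ n)] [AddCommGroup B] [Module (AdicCompletion I O) B] (b₀ : B)
    (hpure : ∀ s : Finset ((B →₀ AdicCompletion I O) × AdicCompletion I O),
      (∀ p ∈ s, Finsupp.linearCombination _ id p.1 = p.2 • b₀) →
      ∃ x : B → AdicCompletion I O, ∀ p ∈ s, Finsupp.linearCombination _ x p.1 = p.2) :
    ∃ r : B →ₗ[AdicCompletion I O] AdicCompletion I O, r b₀ = 1 := by
  -- With these kernels, the quotients are `O ⧸ I ^ n` by surjectivity of evaluation, and
  -- completeness needs no finiteness of `I`.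
  let J (n : ℕ) : Ideal (AdicCompletion I O) := RingHom.ker (AdicCompletion.evalₐ I n)
  have hmem {n : ℕ} {a : AdicCompletion I O} : a ∈ J n ↔ a.val n = 0 := by
    have h : (I ^ n • ⊤ : Ideal O) = I ^ n := by ext x; simp
    exact (Ideal.quotientEquivAlgOfEq O h).map_eq_zero_iff
  have hJ : Antitone J := fun m n hmn a ha ↦ by
    rw [hmem] at ha ⊢
    exact (a.property hmn).symm.trans ((congrArg _ ha).trans (LinearMap.map_zero _))
  have (n : ℕ) : IsArtinian (AdicCompletion I O) (AdicCompletion I O ⧸ J n) := by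
    have : IsArtinianRing (AdicCompletion I O ⧸ J n) :=
      (RingHom.quotientKerEquivOfSurjective (f := (AdicCompletion.evalₐ I n).toRingHom)
        (AdicCompletion.surjective_evalₐ I n)).symm.isArtinianRing
    exact isArtinian_of_surjective_algebraMap (R := AdicCompletion I O ⧸ J n)
      Ideal.Quotient.mk_surjective
  refine _root_.exists_linearForm_eq_one J hJ (fun a ha ↦ ?_) (fun x hx ↦ ?_) b₀ hpure
  · exact AdicCompletion.ext fun n ↦ hmem.mp (ha n)
  · have hx' {m n : ℕ} (hmn : m ≤ n) : x n - x m ∈ J m := by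
      induction n, hmn using Nat.le_induction with
      | base => simp
      | succ n hmn ih =>
        rw [← sub_add_sub_cancel _ (x n)]
        exact add_mem (hJ hmn (hx n)) ih
    -- The limit is the diagonal: its `n`-th component is that of `x n`.
    refine ⟨⟨fun n ↦ (x n).val n, fun {m n} hmn ↦ ?_⟩, fun n ↦ ?_⟩
    · exact ((x n).property hmn).trans (sub_eq_zero.mp (hmem.mp (hx' hmn)))
    · rw [hmem]
      exact sub_self _

/-! ### Purity and finite linear systems -/

/-- A ring map `ψ : A → B` is pure if it remains injective after all base changes `A → A'`. Since
`A' → B ⊗[A] A'` is injective as soon as some extension of `A'` receives `B`, no tensor product is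
mentioned. -/
def IsPureRingHom {A B : Type u} [CommRing A] [CommRing B] (ψ : A →+* B) : Prop :=
  ∀ ⦃A' : Type u⦄ [CommRing A'] (j : A →+* A'), ∃ (B' : Type u) (_ : CommRing B')
    (ι : A' →+* B') (β : B →+* B'), Function.Injective ι ∧ β.comp ψ = ι.comp j

/-- Finite linear systems over `A` that can be solved in a pure extension can be solved in `A`. -/
theorem IsPureRingHom.exists_solution {A B : Type u} [CommRing A] [CommRing B] {ψ : A →+* B}
    (hψ : IsPureRingHom ψ) (s : Finset ((B →₀ A) × A))
    (hs : ∀ p ∈ s, (p.1.sum fun b a ↦ ψ a * b) = ψ p.2) :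
    ∃ x : B → A, ∀ p ∈ s, Finsupp.linearCombination A x p.1 = p.2 := by
  classical
  -- The system is solvable exactly when its right-hand side `c` lies in the span `N` of its
  -- columns. Over `B` it has the tautological solution `b ↦ b`.
  let col (b : B) : s → A := fun p ↦ p.1.1 b
  let N : Submodule A (s → A) := Submodule.span A (Set.range col)
  let c : s → A := fun p ↦ p.1.2
  suffices hc : c ∈ N by
    obtain ⟨x, hx⟩ := Finsupp.mem_span_range_iff_exists_finsupp.mp hc
    refine ⟨x, fun p hp ↦ ?_⟩
    have := congrFun hx ⟨p, hp⟩
    rw [Finsupp.sum_apply'] at this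
    refine Eq.trans ?_ this
    rw [Finsupp.linearCombination_apply,
      Finsupp.sum_of_support_subset p.1 (s := p.1.support ∪ x.support) Finset.subset_union_left _
        (by simp),
      Finsupp.sum_of_support_subset x (s := p.1.support ∪ x.support) Finset.subset_union_right _
        (by simp)]
    refine Finset.sum_congr rfl fun b _ ↦ ?_
    simp [col, mul_comm]
  -- Purity is tested on the square-zero extension `A ⊕ M`, in which the class of `c` is an element.
  -- The solution over `B` kills this class in `B'`, so injectivity of `ι` kills it in `M`.
  let M := (s → A) ⧸ N
  let A' := TrivSqZeroExt A M
  let j : A →+* A' := TrivSqZeroExt.inlHom A M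
  let e (p : s) : A' := TrivSqZeroExt.inr (N.mkQ (Pi.single p 1))
  obtain ⟨B', _, ι, β, hι, hβ'⟩ := hψ j
  have hβ (a : A) : β (ψ a) = ι (j a) := congr($hβ' a)
  have hmk (v : s → A) : ∑ p, j (v p) * e p = TrivSqZeroExt.inr (N.mkQ v) := by
    have hv : v = ∑ p, v p • Pi.single p (1 : A) := by
      simpa using pi_eq_sum_univ' v
    conv_rhs => rw [hv]
    simp only [map_sum, map_smul]
    rw [← TrivSqZeroExt.inrHom_apply A, map_sum]
    exact Finset.sum_congr rfl fun p _ ↦ TrivSqZeroExt.inl_mul_inr _ _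
  have hzero : ι (TrivSqZeroExt.inr (N.mkQ c)) = 0 := by
    let t : Finset B := s.biUnion fun p ↦ p.1.support
    calc
      ι (TrivSqZeroExt.inr (N.mkQ c)) = ∑ p, β (ψ (c p)) * ι (e p) := by
        rw [← hmk, map_sum]
        simp [hβ]
      _ = ∑ p : s, ∑ b ∈ t, ι (j (col b p) * e p) * β b := by
        refine Finset.sum_congr rfl fun p _ ↦ ?_
        rw [← hs p.1 p.2, Finsupp.sum_of_support_subset p.1.1 (s := t)
          (Finset.subset_biUnion_of_mem (fun p ↦ p.1.support) p.2) _ (by simp), map_sum,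
          Finset.sum_mul]
        refine Finset.sum_congr rfl fun b _ ↦ ?_
        rw [map_mul, map_mul, hβ]
        ring
      _ = ∑ b ∈ t, ι (TrivSqZeroExt.inr (N.mkQ (col b))) * β b := by
        rw [Finset.sum_comm]
        refine Finset.sum_congr rfl fun b _ ↦ ?_
        rw [← Finset.sum_mul, ← map_sum, hmk]
      _ = 0 := by
        refine Finset.sum_eq_zero fun b _ ↦ ?_
        have : N.mkQ (col b) = 0 :=
          (Submodule.Quotient.mk_eq_zero _).mpr (Submodule.subset_span ⟨b, rfl⟩)
        rw [this, TrivSqZeroExt.inr_zero, map_zero, zero_mul]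
  have := TrivSqZeroExt.inr_injective (hι (hzero.trans (map_zero ι).symm))
  exact (Submodule.Quotient.mk_eq_zero _).mp this

/-- Purity supplies the finite solvability required for a linear form with value `1` at `1`, and
such a form is a retraction. -/
theorem IsPureRingHom.splitsAsModules {O B : Type u} [CommRing O] [IsLocalRing O]
    [IsNoetherianRing O] [CommRing B]
    {ψ : AdicCompletion (IsLocalRing.maximalIdeal O) O →+* B} (hψ : IsPureRingHom ψ) :
    SplitsAsModules ψ := by
  let := ψ.toAlgebra
  have := isArtinianRing_quotient_maximalIdeal_pow O
  obtain ⟨r, hr⟩ := AdicCompletion.exists_linearForm_eq_one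
    (IsLocalRing.maximalIdeal O) (1 : B) fun s hs ↦
    hψ.exists_solution s fun p hp ↦ by
      have := hs p hp
      rw [Finsupp.linearCombination_apply, ← Algebra.algebraMap_eq_smul_one] at this
      simpa only [Algebra.smul_def] using! this
  refine ⟨r, fun a ↦ ?_⟩
  have : ψ a = a • (1 : B) := Algebra.algebraMap_eq_smul_one a
  rw [this, map_smul, hr, smul_eq_mul, mul_one]

theorem SplitsAsModules.pi {ι : Type u} {A B : ι → Type u} [∀ i, CommRing (A i)]
    [∀ i, CommRing (B i)] {φ : ∀ i, A i →+* B i} (h : ∀ i, SplitsAsModules (φ i)) :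
    SplitsAsModules (RingHom.pi fun i ↦ (φ i).comp (Pi.evalRingHom A i)) := by
  let (i : ι) : Algebra (A i) (B i) := (φ i).toAlgebra
  let := (RingHom.pi fun i ↦ (φ i).comp (Pi.evalRingHom A i)).toAlgebra
  choose r hr using h
  refine ⟨{ toFun := fun b i ↦ r i (b i), map_add' := fun b b' ↦ ?_, map_smul' := fun a b ↦ ?_ }, fun a ↦ ?_⟩
  · exact funext fun i ↦ map_add _ _ _
  · exact funext fun i ↦ (r i).map_smul (a i) (b i)
  · exact funext fun i ↦ hr i (a i)

theorem SplitsAsModules.of_ringEquiv {R S R' S' : Type u} [CommRing R] [CommRing S] [CommRing R']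
    [CommRing S'] {φ : R →+* S} {ψ : R' →+* S'} (h : SplitsAsModules φ) (α : R ≃+* R')
    (β : S ≃+* S') (w : ∀ a, ψ (α a) = β (φ a)) : SplitsAsModules ψ := by
  let := φ.toAlgebra
  let := ψ.toAlgebra
  obtain ⟨r, hr⟩ := h
  refine ⟨{ toFun := fun b ↦ α (r (β.symm b)), map_add' := fun b b' ↦ by simp,
            map_smul' := fun a b ↦ ?_ }, fun a ↦ ?_⟩
  · obtain ⟨a, rfl⟩ := α.surjective a
    have : β.symm (α a • b) = a • β.symm b := by
      rw [Algebra.smul_def, Algebra.smul_def, map_mul]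
      congr 1
      exact β.symm_apply_eq.mpr (w a)
    rw [this, map_smul]
    simp
  · obtain ⟨a, rfl⟩ := α.surjective a
    change α (r (β.symm (ψ (α a)))) = α a
    rw [w, β.symm_apply_apply, hr]

/-! ### Products of flat modules over a Noetherian ring -/

/-- By the equational criterion, each component of a relation is explained by syzygies of its
coefficients. The syzygy module is finitely generated, so one finite matrix of generators serves all
components at once. -/
theorem Module.Flat.pi_of_isNoetherianRing {R : Type*} [CommRing R] [IsNoetherianRing R]
    {ι : Type*} (M : ι → Type*) [∀ i, AddCommGroup (M i)] [∀ i, Module R (M i)]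
    [∀ i, Module.Flat R (M i)] : Module.Flat R (∀ i, M i) := by
  refine Module.Flat.of_forall_isTrivialRelation fun {l f x} h ↦ ?_
  let K : Submodule R (Fin l → R) := LinearMap.ker (Fintype.linearCombination R f)
  have hK (v : Fin l → R) : v ∈ K ↔ ∑ i, f i * v i = 0 := by
    simp [K, Fintype.linearCombination_apply, mul_comm]
  obtain ⟨n, g, hg⟩ := Submodule.fg_iff_exists_fin_generating_family.mp
    (IsNoetherian.noetherian K)
  have hgK (j : Fin n) : ∑ i, f i * g j i = 0 :=
    (hK _).mp (hg ▸ Submodule.subset_span ⟨j, rfl⟩)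
  have key (t : ι) : ∃ y : Fin n → M t, ∀ i, x i t = ∑ j, g j i • y j := by
    have ht : ∑ i, f i • x i t = 0 := by simpa using congrFun h t
    obtain ⟨k, a, y, hy, ha⟩ := Module.Flat.isTrivialRelation_of_sum_smul_eq_zero ht
    have hmem (j : Fin k) : ∃ c : Fin n → R, ∑ m, c m • g m = fun i ↦ a i j := by
      rw [← Submodule.mem_span_range_iff_exists_fun, hg, hK]
      exact ha j
    choose c hc using hmem
    refine ⟨fun m ↦ ∑ j, c j m • y j, fun i ↦ ?_⟩
    refine (hy i).trans ?_
    simp only [Finset.smul_sum, smul_smul]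
    rw [Finset.sum_comm]
    refine Finset.sum_congr rfl fun j _ ↦ ?_
    rw [← Finset.sum_smul, ← congrFun (hc j) i]
    simp [mul_comm]
  choose y hy using key
  exact ⟨n, fun i j ↦ g j i, fun j t ↦ y t j, fun i ↦ funext fun t ↦ by simp [hy t i], hgK⟩

/-! ### Universal injectivity and flatness of ring maps -/

lemma TensorOf.exists_comp_inr_eq {R S A C : Type u} [CommRing R] [CommRing S] [CommRing A]
    [CommRing C] {φ : R →+* S} {γ : R →+* A} (g : S →+* C) (h : A →+* C)
    (w : g.comp φ = h.comp γ) : ∃ l : TensorOf φ γ →+* C, l.comp (inr φ γ) = h := by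
  let := φ.toAlgebra
  let := γ.toAlgebra
  let := (g.comp φ).toAlgebra
  let g' : S →ₐ[R] C := ⟨g, fun _ ↦ rfl⟩
  let h' : A →ₐ[R] C := ⟨h, fun r ↦ congr($w.symm r)⟩
  exact ⟨(Algebra.TensorProduct.productMap g' h').toRingHom,
    RingHom.ext fun a ↦ Algebra.TensorProduct.productMap_right_apply g' h' a⟩

/-- The base change of `S ⊗ A` along `j` is `S ⊗ A'`, and `A' → S ⊗ A'` is again covered by the
hypothesis. -/
lemma isPureRingHom_inr {R S A : Type u} [CommRing R] [CommRing S] [CommRing A] {φ : R →+* S}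
    (hφ : ∀ {A : Type u} [CommRing A] (γ : R →+* A), Function.Injective (TensorOf.inr φ γ))
    (γ : R →+* A) : IsPureRingHom (TensorOf.inr φ γ) := fun _ _ j ↦
  ⟨TensorOf φ (j.comp γ), inferInstance, TensorOf.inr φ (j.comp γ),
    TensorOf.map (RingHom.id R) (RingHom.id S) j (by simp) (by simp), hφ _,
    TensorOf.map_comp_inr _ _ _ _ _⟩

lemma RingHom.Flat.pi {R : Type u} [CommRing R] [IsNoetherianRing R] {ι : Type u} {A : ι → Type u}
    [∀ i, CommRing (A i)] {φ : ∀ i, R →+* A i} (h : ∀ i, (φ i).Flat) :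
    (RingHom.pi φ).Flat := by
  let (i : ι) : Algebra R (A i) := (φ i).toAlgebra
  have (i : ι) : Module.Flat R (A i) := h i
  exact Module.Flat.pi_of_isNoetherianRing A

lemma SplitsAsModules.appTop_specMap {R S : CommRingCat.{u}} {φ : R ⟶ S}
    (h : SplitsAsModules φ.hom) : SplitsAsModules (Spec.map φ).appTop.hom :=
  h.of_ringEquiv (Scheme.ΓSpecIso R).symm.commRingCatIsoToRingEquiv
    (Scheme.ΓSpecIso S).symm.commRingCatIsoToRingEquiv fun a ↦
      congr($(Scheme.ΓSpecIso_inv_naturality φ).hom a).symm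

/-! ### Canonical coverings and faithful flatness -/

namespace Aff

variable {k : Type u} [CommRing k]

/-- A canonical covering stays injective on functions after every affine base change. -/
theorem IsCanonicalCovering.inr_injective {X Y : Aff k} {f : Y ⟶ X} (hf : IsCanonicalCovering f)
    {A : Type u} [CommRing A] (γ : Γ(X.scheme, ⊤) →+* A) :
    Function.Injective (TensorOf.inr (comorphism f) γ) := by
  intro a a' haa'
  let Z := specOver X γ
  let W := specOver X (Polynomial.C : Γ(X.scheme, ⊤) →+* _)
  have hid : comorphism (𝟙 X) = RingHom.id _ := rfl
  -- `W` is the affine line over `X`, and `g b` is the `X`-morphism with coordinate `b`.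
  let g (b : A) : Z ⟶ W := specOverMap (𝟙 X) γ Polynomial.C (Polynomial.eval₂RingHom γ b) <| by
    ext r
    simp [hid]
  have hcov := (Sheaf.canonicalTopology (Aff k)).pullback_stable (specOverTo X γ) hf
  suffices h : g a = g a' by
    have h' := Spec.map_injective (congrArg toScheme h)
    simpa using congr($(h').hom Polynomial.X)
  refine ((Sheaf.isSheaf_yoneda_obj W _ hcov).isSeparatedFor).ext fun V v hv ↦ ?_
  -- Membership in the pulled-back sieve means that `V → Z → X` factors through `f` by some `y`.
  -- Then `O(Y) ⊗ A` maps to `O(V)`, where `a` and `a'` become equal.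
  obtain ⟨_, y, _, ⟨⟩, hy⟩ := hv
  change v ≫ g a = v ≫ g a'
  let v' : V.scheme ⟶ Spec (CommRingCat.of A) := toScheme v
  let ρ : CommRingCat.of A ⟶ Γ(V.scheme, ⊤) := Spec.preimage (V.scheme.isoSpec.inv ≫ v')
  have hρ : Spec.map ρ = V.scheme.isoSpec.inv ≫ v' := Spec.map_preimage _
  have hsq : (comorphism y).comp (comorphism f) = ρ.hom.comp γ := by
    have h₁ : toScheme y ≫ toScheme f =
        v' ≫ Spec.map (CommRingCat.ofHom γ) ≫ X.scheme.isoSpec.inv := congrArg toScheme hy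
    have h₂ : Spec.map ((toScheme f).appTop ≫ (toScheme y).appTop) =
        Spec.map (CommRingCat.ofHom γ ≫ ρ) := by
      rw [← cancel_mono X.scheme.isoSpec.inv, Spec.map_comp, Spec.map_comp, hρ, Category.assoc,
        Category.assoc, Category.assoc, Scheme.isoSpec_inv_naturality,
        Scheme.isoSpec_inv_naturality_assoc, h₁]
    exact congr($(Spec.map_injective h₂).hom)
  obtain ⟨l, hl⟩ := TensorOf.exists_comp_inr_eq _ _ hsq
  have haρ : ρ.hom a = ρ.hom a' := by
    rw [← hl]
    exact congrArg l haa'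
  ext : 2
  change v' ≫ Spec.map (CommRingCat.ofHom (Polynomial.eval₂RingHom γ a)) =
    v' ≫ Spec.map (CommRingCat.ofHom (Polynomial.eval₂RingHom γ a'))
  rw [← cancel_epi V.scheme.isoSpec.inv, ← Category.assoc, ← Category.assoc, ← hρ,
    ← Spec.map_comp, ← Spec.map_comp]
  congr 1
  ext : 1
  refine Polynomial.ringHom_ext (fun r ↦ ?_) ?_
  · simp
  · simpa using haρ

theorem IsCanonicalCovering.splitsAsModules_prodToProdFibre {X Y : Aff k} {f : Y ⟶ X}
    [IsLocallyNoetherian X.scheme] (hf : IsCanonicalCovering f) :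
    SplitsAsModules (prodToProdFibre f) :=
  .pi fun x ↦ (isPureRingHom_inr hf.inr_injective (toCompletedStalk X.scheme x)).splitsAsModules

/-- The map is a localization followed by the completion of a Noetherian ring, and both are flat. -/
lemma flat_toCompletedStalk (X : Scheme.{u}) [IsAffine X] [IsLocallyNoetherian X] (x : X) :
    (toCompletedStalk X x).Flat := by
  refine RingHom.Flat.comp ?_ ?_
  · let := (X.presheaf.germ ⊤ x trivial).hom.toAlgebra
    have := (isAffineOpen_top X).isLocalization_stalk ⟨x, trivial⟩
    exact IsLocalization.flat _ ((isAffineOpen_top X).primeIdealOf ⟨x, trivial⟩).asIdeal.primeCompl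
  · rw [RingHom.flat_algebraMap_iff]
    infer_instance

theorem isFaithfullyFlat_baseTo (X : Aff k) [IsLocallyNoetherian X.scheme] :
    IsFaithfullyFlat (baseTo X) := by
  change Flat (specTo X (toProdCompletion X)) ∧ Surjective (specTo X (toProdCompletion X))
  constructor
  · have : IsNoetherianRing Γ(X.scheme, ⊤) :=
      IsLocallyNoetherian.component_noetherian ⟨⊤, isAffineOpen_top _⟩
    have : Flat (Spec.map (CommRingCat.ofHom (toProdCompletion X))) :=
      Flat.SpecMap_iff.mpr (RingHom.Flat.pi fun x ↦ flat_toCompletedStalk X.scheme x)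
    unfold specTo
    infer_instance
  · refine ⟨fun x ↦ ?_⟩
    -- Projecting to the factor at `x` and then to its residue field lifts the canonical morphism
    -- `Spec κ(x) → X` through `X'`.
    let q : CommRingCat.of (ProdCompletion X) ⟶ X.scheme.residueField x :=
      CommRingCat.ofHom ((AdicCompletion.evalOneₐ (IsLocalRing.maximalIdeal _)).toRingHom.comp
        (Pi.evalRingHom _ x))
    have h : Spec.map q ≫ specTo X (toProdCompletion X) =
        X.scheme.fromSpecResidueField x := by
      rw [specTo, ← Category.assoc, ← Spec.map_comp, Iso.comp_inv_eq, Scheme.isoSpec_hom,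
        Scheme.fromSpecResidueField, Category.assoc, Scheme.fromSpecStalk_toSpecΓ, ← Spec.map_comp]
      rfl
    let z : Spec (X.scheme.residueField x) := IsLocalRing.closedPoint _
    refine ⟨Spec.map q z, ?_⟩
    have := congr($h z)
    rw [Scheme.fromSpecResidueField_apply] at this
    exact this

end Aff

/-! ### Functoriality -/

/-- The equation is a hypothesis and the locality proof is arbitrary, so that this applies to the
stalk map of an identity. -/
lemma completedLocalMap_eq_id {A : Type u} [CommRing A] [IsLocalRing A] {φ : A →+* A}
    {_ : IsLocalHom φ} (h : φ = RingHom.id A) : completedLocalMap φ = RingHom.id _ := by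
  subst h
  refine RingHom.ext fun a ↦ AdicCompletion.ext_evalₐ fun n ↦ ?_
  rw [evalₐ_completedLocalMap, localQuotientMap]
  obtain ⟨b, hb⟩ := Ideal.Quotient.mk_surjective (AdicCompletion.evalₐ _ n a)
  rw [RingHom.id_apply, ← hb]
  rfl

lemma completedLocalMap_eq_comp {A B C : Type u} [CommRing A] [IsLocalRing A] [CommRing B]
    [IsLocalRing B] [CommRing C] [IsLocalRing C] {φ : A →+* B} {ψ : B →+* C} {χ : A →+* C}
    {_ : IsLocalHom φ} {_ : IsLocalHom ψ} {_ : IsLocalHom χ} (h : χ = ψ.comp φ) :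
    completedLocalMap χ = (completedLocalMap ψ).comp (completedLocalMap φ) := by
  subst h
  refine RingHom.ext fun a ↦ AdicCompletion.ext_evalₐ fun n ↦ ?_
  rw [RingHom.comp_apply, evalₐ_completedLocalMap, evalₐ_completedLocalMap,
    evalₐ_completedLocalMap]
  obtain ⟨b, hb⟩ := Ideal.Quotient.mk_surjective (AdicCompletion.evalₐ _ n a)
  rw [← hb]
  rfl

lemma completedStalkMap_id (X : Scheme.{u}) (x : X) :
    completedStalkMap (𝟙 X) x = RingHom.id (CompletedStalk X x) :=
  completedLocalMap_eq_id congr($(Scheme.Hom.stalkMap_id X x).hom)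

lemma completedStalkMap_comp {X Y Z : Scheme.{u}} (f : X ⟶ Y) (g : Y ⟶ Z) (x : X) :
    completedStalkMap (f ≫ g) x =
      (completedStalkMap f x).comp (completedStalkMap g (f x)) :=
  completedLocalMap_eq_comp congr($(Scheme.Hom.stalkMap_comp f g x).hom)

namespace TensorOf

variable {R S A R' S' A' R'' S'' A'' : Type u} [CommRing R] [CommRing S] [CommRing A]
  [CommRing R'] [CommRing S'] [CommRing A'] [CommRing R''] [CommRing S''] [CommRing A'']
  {φ : R →+* S} {γ : R →+* A} {φ' : R' →+* S'} {γ' : R' →+* A'} {φ'' : R'' →+* S''}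
  {γ'' : R'' →+* A''}

lemma map_eq_id {fR : R →+* R} {fS : S →+* S} {fA : A →+* A} (hS : fS.comp φ = φ.comp fR)
    (hA : fA.comp γ = γ.comp fR) (eS : fS = RingHom.id S) (eA : fA = RingHom.id A) :
    map fR fS fA hS hA = RingHom.id _ := by
  apply ringHom_ext
  · rw [map_comp_inl, eS, RingHom.comp_id, RingHom.id_comp]
  · rw [map_comp_inr, eA, RingHom.comp_id, RingHom.id_comp]

lemma map_eq_comp {fR : R →+* R'} {fS : S →+* S'} {fA : A →+* A'} {gR : R' →+* R''}
    {gS : S' →+* S''} {gA : A' →+* A''} {hR : R →+* R''} {hS : S →+* S''} {hA : A →+* A''}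
    (wfS : fS.comp φ = φ'.comp fR) (wfA : fA.comp γ = γ'.comp fR)
    (wgS : gS.comp φ' = φ''.comp gR) (wgA : gA.comp γ' = γ''.comp gR)
    (whS : hS.comp φ = φ''.comp hR) (whA : hA.comp γ = γ''.comp hR)
    (eS : hS = gS.comp fS) (eA : hA = gA.comp fA) :
    map hR hS hA whS whA = (map gR gS gA wgS wgA).comp (map fR fS fA wfS wfA) := by
  apply ringHom_ext
  · rw [map_comp_inl, RingHom.comp_assoc, map_comp_inl, ← RingHom.comp_assoc, map_comp_inl,
      RingHom.comp_assoc, eS]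
  · rw [map_comp_inr, RingHom.comp_assoc, map_comp_inr, ← RingHom.comp_assoc, map_comp_inr,
      RingHom.comp_assoc, eA]

end TensorOf

namespace Aff

variable {k : Type u} [CommRing k]

lemma specOverMap_id {X : Aff k} {A : Type u} [CommRing A] (φ : Γ(X.scheme, ⊤) →+* A)
    (α : A →+* A) (w : α.comp φ = φ.comp (comorphism (𝟙 X))) (hα : α = RingHom.id A) :
    specOverMap (𝟙 X) φ φ α w = 𝟙 _ := by
  subst hα
  ext : 2
  exact Spec.map_id _

lemma prodCompletionMap_id (X : Aff k) : prodCompletionMap (𝟙 X) = RingHom.id _ :=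
  RingHom.ext fun a ↦ funext fun x ↦ congr($(completedStalkMap_id X.scheme x) (a x))

lemma prodCompletionMap_comp_prodCompletionMap {X Y Z : Aff k} (g : X ⟶ Y) (h : Y ⟶ Z) :
    prodCompletionMap (g ≫ h) = (prodCompletionMap g).comp (prodCompletionMap h) :=
  RingHom.ext fun a ↦ funext fun x ↦
    congr($(completedStalkMap_comp (toScheme g) (toScheme h) x) (a _))

lemma prodFibreMap_id (f : Arrow (Aff k)) : prodFibreMap (𝟙 f) = RingHom.id _ :=
  RingHom.ext fun b ↦ funext fun x ↦
    congr($(TensorOf.map_eq_id (comorphism_comp_of_square (𝟙 f))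
      (completedStalkMap_comp_toCompletedStalk (𝟙 f.right.scheme) x) rfl
      (completedStalkMap_id f.right.scheme x)) (b x))

lemma comorphism_comp {X Y Z : Aff k} (g : X ⟶ Y) (h : Y ⟶ Z) :
    comorphism (g ≫ h) = (comorphism g).comp (comorphism h) :=
  congr($(Scheme.Hom.comp_appTop (toScheme g) (toScheme h)).hom)

lemma prodFibreMap_comp_prodFibreMap {f₁ f₂ f₃ : Arrow (Aff k)} (φ : f₁ ⟶ f₂) (ψ : f₂ ⟶ f₃) :
    prodFibreMap (φ ≫ ψ) = (prodFibreMap φ).comp (prodFibreMap ψ) :=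
  RingHom.ext fun b ↦ funext fun x ↦
    congr($(TensorOf.map_eq_comp (comorphism_comp_of_square ψ)
      (completedStalkMap_comp_toCompletedStalk (toScheme ψ.right) (toScheme φ.right x))
      (comorphism_comp_of_square φ)
      (completedStalkMap_comp_toCompletedStalk (toScheme φ.right) x)
      (comorphism_comp_of_square (φ ≫ ψ))
      (completedStalkMap_comp_toCompletedStalk (toScheme φ.right ≫ toScheme ψ.right) x)
      (comorphism_comp φ.left ψ.left)
      (completedStalkMap_comp (toScheme φ.right) (toScheme ψ.right) x)) (b _))

/-- The construction `f ↦ f'` as a functor. -/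
noncomputable def completionFunctor (k : Type u) [CommRing k] : Arrow (Aff k) ⥤ Arrow (Aff k) where
  -- Reusing the prefunctor makes the equality in the main theorem hold by `rfl`.
  __ := completion k
  map_id f := by
    ext1
    · exact specOverMap_id _ _ (prodFibreMap_comp (𝟙 f)) (prodFibreMap_id f)
    · exact specOverMap_id _ _ (prodCompletionMap_comp (𝟙 f.right)) (prodCompletionMap_id f.right)
  map_comp φ ψ := by
    ext1
    · exact (specOverMap_comp_specOverMap φ.left ψ.left _ _ _ _ _ _ _
        (prodFibreMap_comp φ) (prodFibreMap_comp ψ) (prodFibreMap_comp (φ ≫ ψ)) (prodFibreMap_comp_prodFibreMap φ ψ)).symm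
    · exact (specOverMap_comp_specOverMap φ.right ψ.right _ _ _ _ _ _ _
        (prodCompletionMap_comp φ.right) (prodCompletionMap_comp ψ.right)
        (prodCompletionMap_comp (φ.right ≫ ψ.right))
        (prodCompletionMap_comp_prodCompletionMap φ.right ψ.right)).symm

lemma completion_map_comp_completionSquare {f₁ f₂ : Arrow (Aff k)} (φ : f₁ ⟶ f₂) :
    (completion k).map φ ≫ completionSquare f₂ = completionSquare f₁ ≫ φ := by
  ext1
  · exact specOverMap_comp_specOverTo φ.left _ _ _ (prodFibreMap_comp φ)
  · exact specOverMap_comp_specOverTo φ.right _ _ _ (prodCompletionMap_comp φ.right)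

end Aff

/-- The construction `(f : Y → X) ↦ (f' : Y' → X')` is a functor on the arrow category of affine
`k`-schemes, the squares from `f'` to `f` are natural, and, if `X` is Noetherian and `f` is a
canonical covering, then `e : X' → X` is faithfully flat and `O(X') → O(Y')` splits. -/
theorem mainTheorem8 (k : Type u) [CommRing k] :
    (∃ F : Arrow (Aff k) ⥤ Arrow (Aff k), F.toPrefunctor = Aff.completion k) ∧
    (∀ (f₁ f₂ : Arrow (Aff k)) (φ : f₁ ⟶ f₂),
      (Aff.completion k).map φ ≫ Aff.completionSquare f₂ = Aff.completionSquare f₁ ≫ φ) ∧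
    (∀ f : Arrow (Aff k), AlgebraicGeometry.IsNoetherian f.right.scheme → Aff.IsCanonicalCovering f.hom →
      Aff.IsFaithfullyFlat (Aff.completionSquare f).right ∧
      SplitsAsModules (Aff.comorphism ((Aff.completion k).obj f).hom)) := by
  refine ⟨⟨Aff.completionFunctor k, rfl⟩, fun _ _ φ ↦ Aff.completion_map_comp_completionSquare φ,
    fun f _ hf ↦ ⟨Aff.isFaithfullyFlat_baseTo f.right, ?_⟩⟩
  exact SplitsAsModules.appTop_specMap (φ := CommRingCat.ofHom (Aff.prodToProdFibre f.hom))
    hf.splitsAsModules_prodToProdFibre
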